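/- Let $p,q\ge 1$ be integers and let $(\overline M,\overline g,J)$ be a locally metallic Riemannian manifold: a smooth Riemannian manifold with a smooth $(1,1)$-tensor field $J$ such that $J^2=pJ+qI$, $\overline g(JX,Y)=\overline g(X,JY)$ and $\overline\nabla J=0$, where $\overline\nabla$ is the Levi-Civita connection of $\overline g$ (the locally Golden case is $p=q=1$). Let $M$ be a smooth manifold isometrically immersed in $\overline M$ (so $M$ carries the induced metric). For tangent $X,Y$ and normal $V$ let $TX=(JX)^{\top}$ and $nV=(JV)^{\perp}$ be the tangential and the normal part, let $h(X,Y)=(\overline\nabla_XY)^{\perp}$ be the second fundamental form and $A_VX=-(\overline\nabla_XV)^{\top}$ the shape operator. Suppose that $M$ is a proper semi-slant submanifold: $TM=D_1\oplus D_2$ is an orthogonal direct sum of smooth distributions of positive ranks, $J(D_1)=D_1$, and $D_2$ is slant with angle $\theta\neq 0$, i.e. for every $x\in M$ and every nonzero $v\in (D_2)_x$ the angle between $Jv$ and the subspace $(D_2)_x$ (equivalently, between $Jv$ and its orthogonal projection onto $(D_2)_x$; the angle is $\pi/2$ if this projection is $0$) equals the constant $\theta$. Assume that $$A_{nV}X=TA_VX=A_VTX\qquad\text{for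 all } X\in\Gamma(TM),\ V\in\Gamma(T^{\perp}M),$$ and that for all $X\in\Gamma(D_1)$, $Y\in\Gamma(D_2)$ the normal field $h(X,Y)$ is not an eigenvector of the tensor field $n$ with eigenvalue $-\frac qp$ (i.e. it is not the case that $h(X,Y)\not\equiv 0$ and $n\,h(X,Y)=-\frac qp\,h(X,Y)$ on $M$). Then $M$ is $D_1$–$D_2$ mixed totally geodesic: $h(X,Y)=0$ for all $X\in\Gamma(D_1)$ and $Y\in\Gamma(D_2)$. -/

import Mathlib

open Bundle Manifold Set
open scoped ContDiff

namespace MetallicGeometry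

noncomputable section

section Ambient

variable {m : ℕ} {N : Type*} [TopologicalSpace N] [ChartedSpace (EuclideanSpace ℝ (Fin m)) N]
  [IsManifold (𝓡 m) ∞ N]

/-- `X` is a smooth vector field on the manifold `N`, i.e. `X ∈ Γ(TN)`. -/
def IsSmoothField (X : (y : N) → TangentSpace (𝓡 m) y) : Prop :=
  ContMDiff (𝓡 m) (𝓡 m).tangent ∞ (fun y => (⟨y, X y⟩ : TangentBundle (𝓡 m) N))

/-- `D` is a differentiable distribution of rank `d`: near every point, `D` has a frame consisting
of `d` smooth vector fields. -/
def IsSmoothDistribution (d : ℕ) (D : (y : N) → Submodule ℝ (TangentSpace (𝓡 m) y)) : Prop :=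
  ∀ y₀ : N, ∃ U : Set N, IsOpen U ∧ y₀ ∈ U ∧
    ∃ s : Fin d → (y : N) → TangentSpace (𝓡 m) y,
      (∀ j, ContMDiffOn (𝓡 m) (𝓡 m).tangent ∞
        (fun y => (⟨y, s j y⟩ : TangentBundle (𝓡 m) N)) U) ∧
      ∀ y ∈ U, LinearIndependent ℝ (fun j => s j y) ∧
        D y = Submodule.span ℝ (Set.range fun j => s j y)

/-- A field of endomorphisms `J` of the tangent spaces is a smooth tensor field of type `(1,1)`. -/
def IsSmoothEndomorphismField
    (J : (y : N) → TangentSpace (𝓡 m) y →L[ℝ] TangentSpace (𝓡 m) y) : Prop :=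
  ContMDiff (𝓡 m)
    ((𝓡 m).prod 𝓘(ℝ, EuclideanSpace ℝ (Fin m) →L[ℝ] EuclideanSpace ℝ (Fin m))) ∞
    (fun y => TotalSpace.mk' (EuclideanSpace ℝ (Fin m) →L[ℝ] EuclideanSpace ℝ (Fin m))
      (E := fun y : N => TangentSpace (𝓡 m) y →L[ℝ] TangentSpace (𝓡 m) y) y (J y))

variable [RiemannianBundle (fun y : N => TangentSpace (𝓡 m) y)]
  [IsContMDiffRiemannianBundle (𝓡 m) ∞ (EuclideanSpace ℝ (Fin m))
    (fun y : N => TangentSpace (𝓡 m) y)]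

instance isContMDiffRiemannianBundle_one :
    IsContMDiffRiemannianBundle (𝓡 m) 1 (EuclideanSpace ℝ (Fin m))
      (fun y : N => TangentSpace (𝓡 m) y) :=
  IsContMDiffRiemannianBundle.of_le (n := ∞) (by norm_cast)

/-- `∇` is the Levi-Civita connection of the Riemannian manifold `N`. -/
structure IsLeviCivita
    (nabla : CovariantDerivative (𝓡 m) (EuclideanSpace ℝ (Fin m))
      (fun y : N => TangentSpace (𝓡 m) y)) : Prop where
  metric : nabla.IsMetricCompatible
  torsion_free : nabla.torsion = 0

/-- `J` is a metallic Riemannian structure on `N` (for the given metric of `N`):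
a smooth `(1,1)`-tensor field with `J² = pJ + qI`, where `p, q` are positive integers, which is
symmetric for the metric. For `p = q = 1` this is a Golden Riemannian structure. -/
structure IsMetallicRiemannian (p q : ℕ)
    (J : (y : N) → TangentSpace (𝓡 m) y →L[ℝ] TangentSpace (𝓡 m) y) : Prop where
  p_pos : 0 < p
  q_pos : 0 < q
  smooth : IsSmoothEndomorphismField J
  sq : ∀ (y : N) (v : TangentSpace (𝓡 m) y), J y (J y v) = (p : ℝ) • J y v + (q : ℝ) • v
  symm : ∀ (y : N) (v w : TangentSpace (𝓡 m) y), inner ℝ (J y v) w = inner ℝ v (J y w)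

/-- `N` with `J` is a locally metallic Riemannian manifold: `J` is a metallic Riemannian structure
and is parallel, `∇J = 0`, for the Levi-Civita connection `∇`.
(In Mathlib `nabla Y y v` is `∇_v Y` at `y`.) -/
structure IsLocallyMetallicRiemannian (p q : ℕ)
    (nabla : CovariantDerivative (𝓡 m) (EuclideanSpace ℝ (Fin m))
      (fun y : N => TangentSpace (𝓡 m) y))
    (J : (y : N) → TangentSpace (𝓡 m) y →L[ℝ] TangentSpace (𝓡 m) y) : Prop
    extends IsMetallicRiemannian p q J where
  leviCivita : IsLeviCivita nabla
  parallel : ∀ Y : (y : N) → TangentSpace (𝓡 m) y, IsSmoothField Y →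
    ∀ (y : N) (v : TangentSpace (𝓡 m) y),
      nabla (fun z => J z (Y z)) y v = J y (nabla Y y v)

end Ambient

section Submanifold

variable {k m : ℕ}
  {M : Type*} [TopologicalSpace M] [ChartedSpace (EuclideanSpace ℝ (Fin k)) M]
  [IsManifold (𝓡 k) ∞ M]
  {N : Type*} [TopologicalSpace N] [ChartedSpace (EuclideanSpace ℝ (Fin m)) N]
  [IsManifold (𝓡 m) ∞ N]

/-- `f : M → N` is a smooth immersion, so that `M` is an immersed submanifold of `N`. When `N` is
Riemannian, `M` always carries the induced metric
`g(u, v) = ⟨df u, df v⟩`, for which `f` is isometric. -/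
structure IsSmoothImmersion (f : M → N) : Prop where
  smooth : ContMDiff (𝓡 k) (𝓡 m) ∞ f
  injective : ∀ x : M, Function.Injective (mfderiv (𝓡 k) (𝓡 m) f x)

/-- The image of `T_x M` in `T_{f x} N` under the differential of `f`. -/
def tangentImage (f : M → N) (x : M) : Submodule ℝ (TangentSpace (𝓡 m) (f x)) :=
  LinearMap.range (mfderiv (𝓡 k) (𝓡 m) f x).toLinearMap

/-- The image in `T_{f x} N` of a subspace of `T_x M` under the differential of `f`. -/
def pushSubspace (f : M → N) (x : M) (D : Submodule ℝ (TangentSpace (𝓡 k) x)) :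
    Submodule ℝ (TangentSpace (𝓡 m) (f x)) :=
  D.map (mfderiv (𝓡 k) (𝓡 m) f x).toLinearMap

/-- The vector field `f_* X` along `f`. -/
def push (f : M → N) (X : (x : M) → TangentSpace (𝓡 k) x) (x : M) :
    TangentSpace (𝓡 m) (f x) :=
  mfderiv (𝓡 k) (𝓡 m) f x (X x)

/-- `W` is a smooth section of the pullback bundle `f^* TN`. -/
def IsSmoothAlong (f : M → N) (W : (x : M) → TangentSpace (𝓡 m) (f x)) : Prop :=
  ContMDiff (𝓡 k) (𝓡 m).tangent ∞ (fun x => (⟨f x, W x⟩ : TangentBundle (𝓡 m) N))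

/-- The connection induced by `∇` on the pullback bundle `f^* TN`, so that `covAlong nabla f W x v`
is `∇_v W` for a vector field `W` along `f` and `v ∈ T_x M`. In the trivialization
`e` of `TN` around `f x`, write `W = ∑ Wʲ eⱼ` with the
frame `eⱼ` that is constant in `e`; then `∇_v W = ∑ dWʲ(v) eⱼ + ∑ Wʲ(x) ∇_{df v} eⱼ`. -/
def covAlong
    (nabla : CovariantDerivative (𝓡 m) (EuclideanSpace ℝ (Fin m))
      (fun y : N => TangentSpace (𝓡 m) y))
    (f : M → N) (W : (x : M) → TangentSpace (𝓡 m) (f x)) (x : M) (v : TangentSpace (𝓡 k) x) :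
    TangentSpace (𝓡 m) (f x) :=
  let e := trivializationAt (EuclideanSpace ℝ (Fin m))
    (fun y : N => TangentSpace (𝓡 m) y) (f x)
  let coord : M → EuclideanSpace ℝ (Fin m) :=
    fun x' => (e (⟨f x', W x'⟩ : TangentBundle (𝓡 m) N)).2
  e.symm (f x) (mfderiv (𝓡 k) 𝓘(ℝ, EuclideanSpace ℝ (Fin m)) coord x v) +
    nabla (fun y => e.symm y (coord x)) (f x) (mfderiv (𝓡 k) (𝓡 m) f x v)

variable [RiemannianBundle (fun y : N => TangentSpace (𝓡 m) y)]

instance finiteDimensional_tangentSpace (y : N) :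
    FiniteDimensional ℝ (TangentSpace (𝓡 m) y) :=
  inferInstanceAs (FiniteDimensional ℝ (EuclideanSpace ℝ (Fin m)))

/-- The normal space `T_x^⊥ M`. -/
def normalSpace (f : M → N) (x : M) : Submodule ℝ (TangentSpace (𝓡 m) (f x)) :=
  (tangentImage (k := k) f x)ᗮ

/-- `V ∈ Γ(T^⊥ M)`: a smooth normal vector field. -/
def IsSmoothNormalField (f : M → N) (V : (x : M) → TangentSpace (𝓡 m) (f x)) : Prop :=
  IsSmoothAlong (k := k) f V ∧ ∀ x, V x ∈ normalSpace (k := k) f x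

/-- The tangential part of `w ∈ T_{f x} N`, as a vector of `T_x M`: the vector that `df`
(injective for an immersion) sends to the orthogonal projection of `w` to `df(T_x M)`. -/
def tangentialPart (f : M → N) (x : M) (w : TangentSpace (𝓡 m) (f x)) : TangentSpace (𝓡 k) x :=
  Function.invFun (mfderiv (𝓡 k) (𝓡 m) f x) ((tangentImage (k := k) f x).starProjection w)

/-- The normal part of `w ∈ T_{f x} N`. -/
def normalPart (f : M → N) (x : M) (w : TangentSpace (𝓡 m) (f x)) : TangentSpace (𝓡 m) (f x) :=
  (normalSpace (k := k) f x).starProjection w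

/-- `TX = (JX)^T` for tangent vectors. -/
def opT (J : (y : N) → TangentSpace (𝓡 m) y →L[ℝ] TangentSpace (𝓡 m) y) (f : M → N) (x : M)
    (v : TangentSpace (𝓡 k) x) : TangentSpace (𝓡 k) x :=
  tangentialPart f x (J (f x) (mfderiv (𝓡 k) (𝓡 m) f x v))

/-- `nV = (JV)^⊥` for normal vectors. -/
def opn (J : (y : N) → TangentSpace (𝓡 m) y →L[ℝ] TangentSpace (𝓡 m) y) (f : M → N) (x : M)
    (w : TangentSpace (𝓡 m) (f x)) : TangentSpace (𝓡 m) (f x) :=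
  normalPart (k := k) f x (J (f x) w)

/-- The second fundamental form `h(X, Y)`, the normal part of `∇_X Y` (Gauss formula). -/
def secondFundamentalForm
    (nabla : CovariantDerivative (𝓡 m) (EuclideanSpace ℝ (Fin m))
      (fun y : N => TangentSpace (𝓡 m) y))
    (f : M → N) (X Y : (x : M) → TangentSpace (𝓡 k) x) (x : M) : TangentSpace (𝓡 m) (f x) :=
  normalPart (k := k) f x (covAlong nabla f (push f Y) x (X x))

/-- The shape operator `A_V X`, minus the tangential part of `∇_X V` (Weingarten formula). -/
def shapeOperator
    (nabla : CovariantDerivative (𝓡 m) (EuclideanSpace ℝ (Fin m))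
      (fun y : N => TangentSpace (𝓡 m) y))
    (f : M → N) (V : (x : M) → TangentSpace (𝓡 m) (f x)) (X : (x : M) → TangentSpace (𝓡 k) x)
    (x : M) : TangentSpace (𝓡 k) x :=
  -tangentialPart f x (covAlong nabla f V x (X x))

/-- `D` is a slant distribution on `M` with slant angle `θ`: for every nonzero `v ∈ D_x`, the angle
between `J v` and the subspace `D_x`, i.e. between `J v` and its orthogonal projection to `D_x`,
is `θ` (the angle is `π / 2` if this projection vanishes). -/
def IsSlantDistribution (J : (y : N) → TangentSpace (𝓡 m) y →L[ℝ] TangentSpace (𝓡 m) y)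
    (f : M → N) (D : (x : M) → Submodule ℝ (TangentSpace (𝓡 k) x)) (θ : ℝ) : Prop :=
  ∀ (x : M), ∀ v ∈ D x, v ≠ 0 →
    InnerProductGeometry.angle (J (f x) (mfderiv (𝓡 k) (𝓡 m) f x v))
      ((pushSubspace f x (D x)).starProjection (J (f x) (mfderiv (𝓡 k) (𝓡 m) f x v))) = θ

/-- The immersed submanifold `f : M → N` is semi-slant: `TM` is the orthogonal direct sum of
differentiable distributions `D₁`, `D₂` of ranks `d₁`, `d₂` such that `D₁` is invariant,
`J(D₁) = D₁`, and `D₂` is slant with angle `θ ≠ 0`. -/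
structure IsSemiSlant (J : (y : N) → TangentSpace (𝓡 m) y →L[ℝ] TangentSpace (𝓡 m) y)
    (f : M → N) (D₁ D₂ : (x : M) → Submodule ℝ (TangentSpace (𝓡 k) x)) (d₁ d₂ : ℕ) (θ : ℝ) :
    Prop where
  smooth₁ : IsSmoothDistribution d₁ D₁
  smooth₂ : IsSmoothDistribution d₂ D₂
  isCompl : ∀ x, IsCompl (D₁ x) (D₂ x)
  orthogonal : ∀ x, pushSubspace (m := m) f x (D₁ x) ⟂ pushSubspace f x (D₂ x)
  invariant : ∀ x, (pushSubspace f x (D₁ x)).map (J (f x)).toLinearMap = pushSubspace f x (D₁ x)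
  slant : IsSlantDistribution J f D₂ θ
  angle_ne_zero : θ ≠ 0

/-- A semi-slant submanifold is proper if both distributions have positive rank. -/
structure IsProperSemiSlant (J : (y : N) → TangentSpace (𝓡 m) y →L[ℝ] TangentSpace (𝓡 m) y)
    (f : M → N) (D₁ D₂ : (x : M) → Submodule ℝ (TangentSpace (𝓡 k) x)) (d₁ d₂ : ℕ) (θ : ℝ) :
    Prop extends IsSemiSlant J f D₁ D₂ d₁ d₂ θ where
  proper : d₁ * d₂ ≠ 0

/-- `X ∈ Γ(D)`: a smooth vector field with values in the distribution `D`. -/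
def IsSmoothSectionOf (D : (x : M) → Submodule ℝ (TangentSpace (𝓡 k) x))
    (X : (x : M) → TangentSpace (𝓡 k) x) : Prop :=
  IsSmoothField X ∧ ∀ x, X x ∈ D x

/-- A section `W` of the normal bundle is an eigenvector of the tensor field `n` with
eigenvalue `c`: it is not identically zero and `nW = cW`. -/
def IsEigenvectorOfn (J : (y : N) → TangentSpace (𝓡 m) y →L[ℝ] TangentSpace (𝓡 m) y)
    (f : M → N) (c : ℝ) (W : (x : M) → TangentSpace (𝓡 m) (f x)) : Prop :=
  W ≠ 0 ∧ ∀ x, opn (k := k) J f x (W x) = c • W x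

/-- `M` is `D₁`–`D₂` mixed totally geodesic: `h(X, Y) = 0` for all `X ∈ Γ(D₁)`, `Y ∈ Γ(D₂)`. -/
def IsMixedTotallyGeodesic
    (nabla : CovariantDerivative (𝓡 m) (EuclideanSpace ℝ (Fin m))
      (fun y : N => TangentSpace (𝓡 m) y))
    (f : M → N) (D₁ D₂ : (x : M) → Submodule ℝ (TangentSpace (𝓡 k) x)) : Prop :=
  ∀ X Y : (x : M) → TangentSpace (𝓡 k) x, IsSmoothSectionOf D₁ X → IsSmoothSectionOf D₂ Y →
    ∀ x, secondFundamentalForm nabla f X Y x = 0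

end Submanifold

end

end MetallicGeometry

namespace MetallicGeometry

open Filter Topology

noncomputable section

/-! Fix X in D₁, Y in D₂ and a normal V, and put s = A_V X. Duality of the shape operator and the
second fundamental form gives ⟨h(X,Y),V⟩ = ⟨s,Y⟩. With A_{nV}X = TA_VX and the symmetry of n it also
gives ⟨n h(X,Y),V⟩ = ⟨Ts,Y⟩. On D₁ the operator T is J, so T²X = pTX + qX. Since A_V commutes with
T, also T²s = pTs + qs. On D₂, T preserves D₂ and the slant condition gives T² = cos²θ (pT + q). Now
T is symmetric, so ⟨T²s,Y⟩ = ⟨s,T²Y⟩ reads B = cos²θ · B with B = p⟨Ts,Y⟩ + q⟨s,Y⟩. As θ ≠ 0 forces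
cos²θ ≠ 1, B = 0 for every V, that is, p n h(X,Y) + q h(X,Y) = 0. If h(X,Y) did not vanish
identically, it would be an excluded eigenvector. The algebra is `starProjection_sq_of_slant` and
`inner_eq_zero_of_slant`. The analysis is `inner_secondFundamentalForm`, together with extensions of
single vectors to smooth fields, since the hypothesis on A is stated for fields. -/

/-- Product rule for the application of a family of continuous linear maps. -/
theorem mvfderiv_clm_apply {E H M F G : Type*} [NormedAddCommGroup E] [NormedSpace ℝ E]
    [TopologicalSpace H] {I : ModelWithCorners ℝ E H} [TopologicalSpace M] [ChartedSpace H M]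
    [NormedAddCommGroup F] [NormedSpace ℝ F] [NormedAddCommGroup G] [NormedSpace ℝ G]
    {c : M → F →L[ℝ] G} {u : M → F} {x : M}
    (hc : MDifferentiableAt I 𝓘(ℝ, F →L[ℝ] G) c x) (hu : MDifferentiableAt I 𝓘(ℝ, F) u x)
    (v : TangentSpace I x) :
    mvfderiv I (fun y => c y (u y)) x v = c x (mvfderiv I u x v) + mvfderiv I c x v (u x) := by
  let c' : E →L[ℝ] F →L[ℝ] G := mvfderiv I c x
  let u' : E →L[ℝ] F := mvfderiv I u x
  have h : HasMFDerivAt I 𝓘(ℝ, G) (fun y => c y (u y)) x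
      ((c x).comp u' + c'.flip (u x) : E →L[ℝ] G) := by
    refine ⟨?_, ?_⟩
    · exact (isBoundedBilinearMap_apply (𝕜 := ℝ) (E := F) (F := G)).continuous.continuousAt.comp
        (hc.continuousAt.prodMk hu.continuousAt)
    -- The Fréchet product rule in the chart at `x`; the charts of the target spaces are identities.
    · have h1 := hc.hasMFDerivAt.2.clm_apply hu.hasMFDerivAt.2
      simp only [writtenInExtChartAt, extChartAt_self_eq, Function.comp_apply,
        extChartAt_to_inv] at h1
      exact h1
  exact DFunLike.congr_fun h.mfderiv v

/-! ### Metric compatibility of the connection along f -/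

section Along

variable {k m : ℕ}
  {M : Type*} [TopologicalSpace M] [ChartedSpace (EuclideanSpace ℝ (Fin k)) M]
  {N : Type*} [TopologicalSpace N] [ChartedSpace (EuclideanSpace ℝ (Fin m)) N]
  [IsManifold (𝓡 m) ∞ N]

variable [RiemannianBundle (fun y : N => TangentSpace (𝓡 m) y)]
  [IsContMDiffRiemannianBundle (𝓡 m) ∞ (EuclideanSpace ℝ (Fin m))
    (fun y : N => TangentSpace (𝓡 m) y)]

/-- Near a point, the metric read in a trivialization is a differentiable family of
bilinear forms. -/
theorem exists_metric_coord (y₀ : N) :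
    ∃ B : N → EuclideanSpace ℝ (Fin m) →L[ℝ] EuclideanSpace ℝ (Fin m) →L[ℝ] ℝ,
      MDifferentiableAt (𝓡 m) 𝓘(ℝ, EuclideanSpace ℝ (Fin m) →L[ℝ] EuclideanSpace ℝ (Fin m) →L[ℝ] ℝ)
        B y₀ ∧
      ∀ y ∈ (trivializationAt (EuclideanSpace ℝ (Fin m))
          (fun y : N => TangentSpace (𝓡 m) y) y₀).baseSet, ∀ a b,
        B y a b = inner ℝ
          ((trivializationAt (EuclideanSpace ℝ (Fin m))
            (fun y : N => TangentSpace (𝓡 m) y) y₀).symm y a)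
          ((trivializationAt (EuclideanSpace ℝ (Fin m))
            (fun y : N => TangentSpace (𝓡 m) y) y₀).symm y b) := by
  obtain ⟨g, hg, hgi⟩ := IsContMDiffRiemannianBundle.exists_contMDiff (IB := 𝓡 m) (n := ∞)
    (F := EuclideanSpace ℝ (Fin m)) (E := fun y : N => TangentSpace (𝓡 m) y)
  -- The witness is `g` in coordinates, supplied by the smoothness criterion for sections of a hom
  -- bundle.
  refine ⟨_, ((contMDiffAt_hom_bundle _).1 (hg y₀)).2.mdifferentiableAt (by simp), ?_⟩
  intro y hy a b
  rw [hgi]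
  have h := inCoordinates_apply_eq₂ (𝕜 := ℝ) (E₁ := fun y : N => TangentSpace (𝓡 m) y)
    (E₂ := fun y : N => TangentSpace (𝓡 m) y) (F₃ := ℝ) (E₃ := Bundle.Trivial N ℝ)
    (ϕ := g y) (v := a) (w := b) hy hy (Set.mem_univ _)
  simpa using h

/-- Product rule for the inner product of two fields along `f`, when the connection is metric. -/
theorem mvfderiv_inner_along
    {nabla : CovariantDerivative (𝓡 m) (EuclideanSpace ℝ (Fin m))
      (fun y : N => TangentSpace (𝓡 m) y)} (hmetric : nabla.IsMetricCompatible)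
    {f : M → N} {W₁ W₂ : (x : M) → TangentSpace (𝓡 m) (f x)} {x : M}
    (h₁ : MDifferentiableAt (𝓡 k) (𝓡 m).tangent
      (fun x => (⟨f x, W₁ x⟩ : TangentBundle (𝓡 m) N)) x)
    (h₂ : MDifferentiableAt (𝓡 k) (𝓡 m).tangent
      (fun x => (⟨f x, W₂ x⟩ : TangentBundle (𝓡 m) N)) x)
    (v : TangentSpace (𝓡 k) x) :
    mfderiv (𝓡 k) 𝓘(ℝ, ℝ) (fun x' => (inner ℝ (W₁ x') (W₂ x') : ℝ)) x v =
      (inner ℝ (covAlong nabla f W₁ x v) (W₂ x) + inner ℝ (W₁ x) (covAlong nabla f W₂ x v) : ℝ) := by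
  obtain ⟨B, hB, hBi⟩ := exists_metric_coord (m := m) (f x)
  rw [mdifferentiableAt_totalSpace] at h₁ h₂
  obtain ⟨hf, h₁⟩ := h₁
  obtain ⟨-, h₂⟩ := h₂
  dsimp only at hf h₁ h₂
  set e := trivializationAt (EuclideanSpace ℝ (Fin m))
    (fun y : N => TangentSpace (𝓡 m) y) (f x)
  set c₁ : M → EuclideanSpace ℝ (Fin m) :=
    fun x' => (e (⟨f x', W₁ x'⟩ : TangentBundle (𝓡 m) N)).2
  set c₂ : M → EuclideanSpace ℝ (Fin m) :=
    fun x' => (e (⟨f x', W₂ x'⟩ : TangentBundle (𝓡 m) N)).2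
  have hx : f x ∈ e.baseSet := FiberBundle.mem_baseSet_trivializationAt' (f x)
  have hev : ∀ᶠ x' in 𝓝 x, f x' ∈ e.baseSet :=
    hf.continuousAt.eventually (e.open_baseSet.mem_nhds hx)
  have hs : ∀ (W : (x : M) → TangentSpace (𝓡 m) (f x)) x', f x' ∈ e.baseSet →
      e.symm (f x') (e (⟨f x', W x'⟩ : TangentBundle (𝓡 m) N)).2 = W x' :=
    fun W x' hx' => e.symm_apply_apply_mk hx' (W x')
  have hBf : MDifferentiableAt (𝓡 k) _ (fun x' => B (f x')) x := hB.comp x hf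
  have key : (fun x' => (inner ℝ (W₁ x') (W₂ x') : ℝ)) =ᶠ[𝓝 x]
      fun x' => B (f x') (c₁ x') (c₂ x') := by
    filter_upwards [hev] with x' hx'
    rw [hBi _ hx', hs W₁ x' hx', hs W₂ x' hx']
  -- The frame-constant fields in `covAlong` are the extensions `FiberBundle.extend` of W₁ x and W₂
  -- x. Metric compatibility on N, applied to them, computes the derivative of the metric
  -- coefficients with c₁ x, c₂ x frozen.
  have ext₁ : (fun y => e.symm y (c₁ x)) =
      FiberBundle.extend (EuclideanSpace ℝ (Fin m)) (W₁ x) := rfl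
  have ext₂ : (fun y => e.symm y (c₂ x)) =
      FiberBundle.extend (EuclideanSpace ℝ (Fin m)) (W₂ x) := rfl
  have hm := hmetric.mvfderiv_inner_eq
    (FiberBundle.extend (EuclideanSpace ℝ (Fin m)) (mfderiv (𝓡 k) (𝓡 m) f x v))
    (FiberBundle.mdifferentiableAt_extend (𝓡 m) (EuclideanSpace ℝ (Fin m)) (W₁ x))
    (FiberBundle.mdifferentiableAt_extend (𝓡 m) (EuclideanSpace ℝ (Fin m)) (W₂ x))
  have keyN : (fun y => (inner ℝ (FiberBundle.extend (EuclideanSpace ℝ (Fin m)) (W₁ x) y)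
      (FiberBundle.extend (EuclideanSpace ℝ (Fin m)) (W₂ x) y) : ℝ)) =ᶠ[𝓝 (f x)]
      fun y => B y (c₁ x) (c₂ x) := by
    filter_upwards [e.open_baseSet.mem_nhds hx] with y hy
    rw [hBi _ hy, ← ext₁, ← ext₂]
  have hmN := congrArg (fun φ : TangentSpace (𝓡 m) (f x) →L[ℝ] ℝ =>
    φ (mfderiv (𝓡 k) (𝓡 m) f x v)) (keyN.mfderiv_eq (I := 𝓡 m) (I' := 𝓘(ℝ, ℝ)))
  have hcomp := mvfderiv_comp_apply (g := fun y => B y (c₁ x) (c₂ x)) x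
    ((hB.clm_apply mdifferentiableAt_const).clm_apply mdifferentiableAt_const) hf v
  have hprod := mvfderiv_clm_apply (hBf.clm_apply h₁) h₂ v
  rw [mvfderiv_clm_apply hBf h₁ v] at hprod
  have hconst := mvfderiv_clm_apply (hBf.clm_apply (mdifferentiableAt_const (c := c₁ x)))
    (mdifferentiableAt_const (c := c₂ x)) v
  rw [mvfderiv_clm_apply hBf mdifferentiableAt_const v] at hconst
  simp only [mvfderiv_const, zero_apply, map_zero, zero_add] at hconst
  have hcov₁ : covAlong nabla f W₁ x v = e.symm (f x) (mvfderiv (𝓡 k) c₁ x v) +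
      nabla (FiberBundle.extend (EuclideanSpace ℝ (Fin m)) (W₁ x)) (f x)
        (mfderiv (𝓡 k) (𝓡 m) f x v) := rfl
  have hcov₂ : covAlong nabla f W₂ x v = e.symm (f x) (mvfderiv (𝓡 k) c₂ x v) +
      nabla (FiberBundle.extend (EuclideanSpace ℝ (Fin m)) (W₂ x)) (f x)
        (mfderiv (𝓡 k) (𝓡 m) f x v) := rfl
  rw [key.mfderiv_eq, hcov₁, hcov₂, inner_add_left, inner_add_right]
  refine hprod.trans ?_
  simp only [FiberBundle.extend_apply_self] at hm
  -- The derivative of B ∘ f yields the two connection terms of `covAlong`; the derivatives of c₁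
  -- and c₂ yield the remaining two.
  have hd : mvfderiv (𝓡 k) (fun x' => B (f x')) x v (c₁ x) (c₂ x) =
      inner ℝ (nabla (FiberBundle.extend (EuclideanSpace ℝ (Fin m)) (W₁ x)) (f x)
        (mfderiv (𝓡 k) (𝓡 m) f x v)) (W₂ x) +
      inner ℝ (W₁ x) (nabla (FiberBundle.extend (EuclideanSpace ℝ (Fin m)) (W₂ x)) (f x)
        (mfderiv (𝓡 k) (𝓡 m) f x v)) :=
    hconst.symm.trans (hcomp.trans (hmN.symm.trans hm))
  rw [add_apply, hd, hBi _ hx, hBi _ hx, hs W₁ x hx, hs W₂ x hx]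
  ring

end Along
-- Smooth fields along f, their extension and their normal projection
section SmoothAlong

variable {k m : ℕ}
  {M : Type*} [TopologicalSpace M] [ChartedSpace (EuclideanSpace ℝ (Fin k)) M]
  {N : Type*} [TopologicalSpace N] [ChartedSpace (EuclideanSpace ℝ (Fin m)) N]
  [IsManifold (𝓡 m) ∞ N]

/-- The field `W` along `f` is smooth at the point `x`. -/
def IsSmoothAlongAt (f : M → N) (W : (x : M) → TangentSpace (𝓡 m) (f x)) (x : M) : Prop :=
  ContMDiffAt (𝓡 k) (𝓡 m).tangent ∞ (fun x => (⟨f x, W x⟩ : TangentBundle (𝓡 m) N)) x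

variable {f : M → N} {W W₁ W₂ : (x : M) → TangentSpace (𝓡 m) (f x)} {x : M}

theorem IsSmoothAlongAt.base (h : IsSmoothAlongAt (k := k) f W x) : ContMDiffAt (𝓡 k) (𝓡 m) ∞ f x :=
  (contMDiffAt_totalSpace.1 h).1

theorem IsSmoothAlongAt.congr (h : IsSmoothAlongAt (k := k) f W₁ x) (he : ∀ᶠ y in 𝓝 x, W₂ y = W₁ y) :
    IsSmoothAlongAt (k := k) f W₂ x := by
  refine ContMDiffAt.congr_of_eventuallyEq h ?_
  filter_upwards [he] with y hy
  rw [hy]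

theorem eventually_mem_trivializationAt_baseSet (hf : ContMDiffAt (𝓡 k) (𝓡 m) ∞ f x) :
    ∀ᶠ y in 𝓝 x, f y ∈ (trivializationAt (EuclideanSpace ℝ (Fin m))
      (fun y : N => TangentSpace (𝓡 m) y) (f x)).baseSet :=
  hf.continuousAt.eventually ((trivializationAt (EuclideanSpace ℝ (Fin m))
      (fun y : N => TangentSpace (𝓡 m) y) (f x)).open_baseSet.mem_nhds
        (FiberBundle.mem_baseSet_trivializationAt' (f x)))

theorem IsSmoothAlongAt.add (h₁ : IsSmoothAlongAt (k := k) f W₁ x) (h₂ : IsSmoothAlongAt (k := k) f W₂ x) :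
    IsSmoothAlongAt (k := k) f (fun y => W₁ y + W₂ y) x := by
  refine contMDiffAt_totalSpace.2 ⟨h₁.base, ?_⟩
  refine ((contMDiffAt_totalSpace.1 h₁).2.add (contMDiffAt_totalSpace.1 h₂).2
    ).congr_of_eventuallyEq ?_
  filter_upwards [eventually_mem_trivializationAt_baseSet h₁.base] with y hy
  exact ((trivializationAt (EuclideanSpace ℝ (Fin m))
      (fun y : N => TangentSpace (𝓡 m) y) (f x)).linear ℝ hy).map_add (W₁ y) (W₂ y)

theorem IsSmoothAlongAt.smul {φ : M → ℝ} (hφ : ContMDiffAt (𝓡 k) 𝓘(ℝ, ℝ) ∞ φ x)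
    (h : IsSmoothAlongAt (k := k) f W x) :
    IsSmoothAlongAt (k := k) f (fun y => φ y • W y) x := by
  refine contMDiffAt_totalSpace.2 ⟨h.base, ?_⟩
  refine (hφ.smul (contMDiffAt_totalSpace.1 h).2).congr_of_eventuallyEq ?_
  filter_upwards [eventually_mem_trivializationAt_baseSet h.base] with y hy
  exact ((trivializationAt (EuclideanSpace ℝ (Fin m))
      (fun y : N => TangentSpace (𝓡 m) y) (f x)).linear ℝ hy).map_smul (φ y) (W y)

theorem IsSmoothAlongAt.zero (hf : ContMDiffAt (𝓡 k) (𝓡 m) ∞ f x) :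
    IsSmoothAlongAt (k := k) (m := m) f (fun _ => 0) x :=
  (Bundle.contMDiff_zeroSection (IB := 𝓡 m) (F := EuclideanSpace ℝ (Fin m)) ℝ
    (fun y : N => TangentSpace (𝓡 m) y)).contMDiffAt.comp x hf

theorem IsSmoothAlongAt.sub (h₁ : IsSmoothAlongAt (k := k) f W₁ x) (h₂ : IsSmoothAlongAt (k := k) f W₂ x) :
    IsSmoothAlongAt (k := k) f (fun y => W₁ y - W₂ y) x :=
  (h₁.add (smul (φ := fun _ => (-1 : ℝ)) contMDiffAt_const h₂)).congr
    (.of_forall fun y => by simp [sub_eq_add_neg])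

theorem IsSmoothAlongAt.endomorphism {J : (y : N) → TangentSpace (𝓡 m) y →L[ℝ] TangentSpace (𝓡 m) y}
    (hJ : IsSmoothEndomorphismField J) (h : IsSmoothAlongAt (k := k) f W x) :
    IsSmoothAlongAt (k := k) f (fun y => J (f y) (W y)) x :=
  ContMDiffAt.clm_bundle_apply (b := f) (ϕ := fun y => J (f y))
    ((hJ (f x)).comp x h.base) h

theorem isSmoothAlongAt_mfderiv [IsManifold (𝓡 k) ∞ M]
    (hf : ContMDiff (𝓡 k) (𝓡 m) ∞ f)
    {X : (x : M) → TangentSpace (𝓡 k) x} {x : M}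
    (hX : ContMDiffAt (𝓡 k) (𝓡 k).tangent ∞ (fun y => (⟨y, X y⟩ : TangentBundle (𝓡 k) M)) x) :
    IsSmoothAlongAt (k := k) f (fun y => mfderiv (𝓡 k) (𝓡 m) f y (X y)) x :=
  ContMDiffAt.comp (g := tangentMap (𝓡 k) (𝓡 m) f)
    (f := fun y => (⟨y, X y⟩ : TangentBundle (𝓡 k) M)) x
    (hf.contMDiff_tangentMap (m := ∞) (by simp)).contMDiffAt hX

/-- Every vector at a point extends to a globally smooth field along `f`. -/
theorem exists_isSmoothAlong_extension [T2Space M] [IsManifold (𝓡 k) ∞ M]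
    (hf : ContMDiff (𝓡 k) (𝓡 m) ∞ f) (x : M) (w : TangentSpace (𝓡 m) (f x)) :
    ∃ W : (x : M) → TangentSpace (𝓡 m) (f x), IsSmoothAlong (k := k) f W ∧ W x = w := by
  obtain ⟨s, hs, hext⟩ := FiberBundle.exists_contMDiffOn_extend (k := ∞) (𝓡 m)
    (EuclideanSpace ℝ (Fin m)) w
  have hs' : f ⁻¹' interior s ∈ 𝓝 x :=
    hf.continuous.continuousAt (interior_mem_nhds.2 hs)
  -- The cutoff is supported where f lands in the region of smoothness of the local extension; off
  -- its support the product is locally zero.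
  obtain ⟨χ, -, hχ⟩ := (SmoothBumpFunction.nhds_basis_tsupport (I := 𝓡 k) x).mem_iff.1 hs'
  refine ⟨fun y => χ y • FiberBundle.extend (EuclideanSpace ℝ (Fin m)) w (f y), fun y => ?_, ?_⟩
  · by_cases hy : y ∈ tsupport χ
    · refine IsSmoothAlongAt.smul χ.contMDiff.contMDiffAt ?_
      have := hext.contMDiffAt (mem_interior_iff_mem_nhds.1 (hχ hy))
      exact this.comp y hf.contMDiffAt
    · refine (IsSmoothAlongAt.zero hf.contMDiffAt).congr ?_
      filter_upwards [(isClosed_tsupport χ).isOpen_compl.mem_nhds hy] with z hz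
      rw [image_eq_zero_of_notMem_tsupport hz, zero_smul]
  · simp

variable [RiemannianBundle (fun y : N => TangentSpace (𝓡 m) y)]

theorem starProjection_congr {E : Type*} [NormedAddCommGroup E]
    [InnerProductSpace ℝ E] {K L : Submodule ℝ E} [K.HasOrthogonalProjection]
    [L.HasOrthogonalProjection] (h : K = L) (w : E) : K.starProjection w = L.starProjection w := by
  subst h
  rfl

/-- One Gram–Schmidt step for the projection onto the span of a finite family. -/
theorem starProjection_span_snoc {E : Type*} [NormedAddCommGroup E]
    [InnerProductSpace ℝ E] [FiniteDimensional ℝ E] {n : ℕ} (s : Fin (n + 1) → E) (w : E) :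
    (Submodule.span ℝ (range s)).starProjection w =
      (Submodule.span ℝ (range fun i : Fin n => s i.castSucc)).starProjection w +
      (inner ℝ (s (Fin.last n) - (Submodule.span ℝ
          (range fun i : Fin n => s i.castSucc)).starProjection (s (Fin.last n))) w /
        inner ℝ (s (Fin.last n) - (Submodule.span ℝ
          (range fun i : Fin n => s i.castSucc)).starProjection (s (Fin.last n)))
          (s (Fin.last n) - (Submodule.span ℝ
          (range fun i : Fin n => s i.castSucc)).starProjection (s (Fin.last n)))) •
        (s (Fin.last n) - (Submodule.span ℝ
          (range fun i : Fin n => s i.castSucc)).starProjection (s (Fin.last n))) := by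
  set K := Submodule.span ℝ (range fun i : Fin n => s i.castSucc) with hK
  set u := s (Fin.last n) - K.starProjection (s (Fin.last n)) with hu
  have hKu : u ∈ Kᗮ := K.sub_starProjection_mem_orthogonal _
  have hle : K ≤ Submodule.span ℝ (range s) := by
    refine Submodule.span_mono ?_
    rintro _ ⟨i, rfl⟩
    exact ⟨_, rfl⟩
  have hlast : s (Fin.last n) ∈ Submodule.span ℝ (range s) := Submodule.subset_span ⟨_, rfl⟩
  have hus : u ∈ Submodule.span ℝ (range s) :=
    Submodule.sub_mem _ hlast (hle (K.starProjection_apply_mem _))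
  refine Submodule.eq_starProjection_of_mem_orthogonal
    (Submodule.add_mem _ (hle (K.starProjection_apply_mem _)) (Submodule.smul_mem _ _ hus)) ?_
  set r : E := w - (K.starProjection w + (inner ℝ u w / inner ℝ u u) • u) with hr
  have hrK : ∀ z ∈ K, inner ℝ z r = 0 := by
    intro z hz
    have h1 : inner ℝ z (w - K.starProjection w) = 0 :=
      K.sub_starProjection_mem_orthogonal w z hz
    have h2 : inner ℝ z u = 0 := hKu z hz
    rw [hr, ← sub_sub, inner_sub_right, h1, inner_smul_right, h2]
    simp
  have hru : inner ℝ u r = 0 := by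
    have h1 : inner ℝ u (K.starProjection w) = 0 := by
      rw [real_inner_comm]; exact hKu _ (K.starProjection_apply_mem _)
    rw [hr, inner_sub_right, inner_add_right, h1, inner_smul_right]
    -- When the last vector already lies in K, the coefficient is 0/0 = 0 and the formula survives,
    -- so no independence is needed.
    by_cases h0 : u = 0
    · simp [h0]
    · have : inner ℝ u u ≠ 0 := inner_self_ne_zero.2 h0
      field_simp
      ring
  rw [Submodule.mem_orthogonal]
  intro z hz
  induction hz using Submodule.span_induction with
  | mem z hz =>
    obtain ⟨i, rfl⟩ := hz
    induction i using Fin.lastCases with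
    | last =>
      have : s (Fin.last n) = u + K.starProjection (s (Fin.last n)) := by rw [hu]; abel
      rw [this, inner_add_left, hru, hrK _ (K.starProjection_apply_mem _), add_zero]
    | cast i => exact hrK _ (Submodule.subset_span ⟨i, rfl⟩)
  | zero => simp
  | add a b _ _ ha hb => rw [inner_add_left, ha, hb, add_zero]
  | smul a b _ hb => rw [inner_smul_left, hb, mul_zero]

variable [IsContMDiffRiemannianBundle (𝓡 m) ∞ (EuclideanSpace ℝ (Fin m))
    (fun y : N => TangentSpace (𝓡 m) y)]

theorem IsSmoothAlongAt.inner (h₁ : IsSmoothAlongAt (k := k) f W₁ x) (h₂ : IsSmoothAlongAt (k := k) f W₂ x) :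
    ContMDiffAt (𝓡 k) 𝓘(ℝ, ℝ) ∞ (fun y => (inner ℝ (W₁ y) (W₂ y) : ℝ)) x :=
  ContMDiffAt.inner_bundle h₁ h₂

/-- Gram–Schmidt by induction on the number of spanning fields: each step adds a quotient of smooth
inner products times a smooth field. Independence at the single point x keeps the denominator
nonzero there, which is enough for smoothness at x. -/
theorem IsSmoothAlongAt.starProjection_span {n : ℕ} {s : Fin n → (x : M) → TangentSpace (𝓡 m) (f x)}
    (hs : ∀ i, IsSmoothAlongAt (k := k) f (s i) x) (hli : LinearIndependent ℝ fun i => s i x)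
    (hW : IsSmoothAlongAt (k := k) f W x) :
    IsSmoothAlongAt (k := k) f
      (fun y => (Submodule.span ℝ (range fun i => s i y)).starProjection (W y)) x := by
  induction n generalizing W with
  | zero =>
    refine (zero hW.base).congr (.of_forall fun y => ?_)
    simp
  | succ n ih =>
    have hli' : LinearIndependent ℝ fun i : Fin n => s i.castSucc x :=
      hli.comp _ (Fin.castSucc_injective n)
    have hP := fun {W} hW => ih (W := W) (fun i => hs i.castSucc) hli' hW
    have hu := (hs (Fin.last n)).sub (hP (hs (Fin.last n)))
    refine ((hP hW).add (smul ((hu.inner hW).div₀ (hu.inner hu) ?_) hu)).congr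
      (.of_forall fun y => starProjection_span_snoc (fun i => s i y) (W y))
    rw [inner_self_ne_zero, sub_ne_zero]
    intro h
    have hmem : s (Fin.last n) x ∈ Submodule.span ℝ (range fun i : Fin n => s i.castSucc x) := by
      rw [h]
      exact Submodule.starProjection_apply_mem _ _
    have := (linearIndependent_finSucc'.1 hli).2
    exact this hmem

-- Frame-constant extension from T_xM to T_yM is a composite of two fibre isomorphisms, so it
-- carries a basis to a basis.
omit [IsManifold (𝓡 m) ∞ N] [RiemannianBundle (fun y : N => TangentSpace (𝓡 m) y)]
  [IsContMDiffRiemannianBundle (𝓡 m) ∞ (EuclideanSpace ℝ (Fin m))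
    (fun y : N => TangentSpace (𝓡 m) y)] in
theorem span_range_mfderiv_extend (f : M → N) {x y : M}
    [IsManifold (𝓡 k) ∞ M] (b : Module.Basis (Fin k) ℝ (TangentSpace (𝓡 k) x))
    (hy : y ∈ (trivializationAt (EuclideanSpace ℝ (Fin k))
      (fun y : M => TangentSpace (𝓡 k) y) x).baseSet) :
    Submodule.span ℝ (range fun i : Fin k => mfderiv (𝓡 k) (𝓡 m) f y
      (FiberBundle.extend (EuclideanSpace ℝ (Fin k)) (b i) y)) =
      tangentImage (k := k) (m := m) f y := by
  set e := trivializationAt (EuclideanSpace ℝ (Fin k)) (fun y : M => TangentSpace (𝓡 k) y) x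
  have hx : x ∈ e.baseSet := FiberBundle.mem_baseSet_trivializationAt' x
  let L : TangentSpace (𝓡 k) x ≃L[ℝ] TangentSpace (𝓡 k) y :=
    (e.continuousLinearEquivAt ℝ x hx).trans (e.continuousLinearEquivAt ℝ y hy).symm
  have hL : ∀ v : TangentSpace (𝓡 k) x,
      FiberBundle.extend (EuclideanSpace ℝ (Fin k)) v y = L v := fun v => by
    change e.symm y (e ⟨x, v⟩).2 = (e.continuousLinearEquivAt ℝ y hy).symm
      (e.continuousLinearEquivAt ℝ x hx v)
    rw [e.symm_continuousLinearEquivAt_eq hy, e.symmL_apply hy]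
    rfl
  simp only [hL]
  let A : TangentSpace (𝓡 k) x →ₗ[ℝ] TangentSpace (𝓡 m) (f y) :=
    (mfderiv (𝓡 k) (𝓡 m) f y).toLinearMap ∘ₗ L.toLinearEquiv.toLinearMap
  have h1 : Submodule.span ℝ (range (A ∘ b)) = LinearMap.range A := by
    rw [range_comp, ← Submodule.map_span, b.span_eq, Submodule.map_top]
  have h2 : LinearMap.range A = tangentImage (k := k) (m := m) f y := by
    rw [LinearMap.range_comp_of_range_eq_top _ (LinearEquiv.range _)]
    rfl
  rw [← h2, ← h1]
  congr 2

omit [IsManifold (𝓡 m) ∞ N] [IsContMDiffRiemannianBundle (𝓡 m) ∞ (EuclideanSpace ℝ (Fin m))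
    (fun y : N => TangentSpace (𝓡 m) y)] in
theorem normalPart_eq_sub (f : M → N) (x : M)
    (w : TangentSpace (𝓡 m) (f x)) :
    MetallicGeometry.normalPart (k := k) f x w =
      w - (tangentImage (k := k) f x).starProjection w :=
  Submodule.starProjection_orthogonal_val _

/-- Near x the tangent image is spanned by the pushed-forward local frame, which is independent at x
because df is injective. Hence the tangential projection is smooth, and so is its complement. -/
theorem IsSmoothAlongAt.normalPart [IsManifold (𝓡 k) ∞ M] (hf : IsSmoothImmersion (k := k) (m := m) f)
    (hW : IsSmoothAlongAt (k := k) f W x) :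
    IsSmoothAlongAt (k := k) f (fun y => MetallicGeometry.normalPart (k := k) f y (W y)) x := by
  let b : Module.Basis (Fin k) ℝ (TangentSpace (𝓡 k) x) :=
    (EuclideanSpace.basisFun (Fin k) ℝ).toBasis
  set s : Fin k → (y : M) → TangentSpace (𝓡 m) (f y) := fun i y => mfderiv (𝓡 k) (𝓡 m) f y
    (FiberBundle.extend (EuclideanSpace ℝ (Fin k)) (b i) y) with hs
  have hsm : ∀ i, IsSmoothAlongAt (k := k) f (s i) x := fun i =>
    isSmoothAlongAt_mfderiv hf.smooth (FiberBundle.contMDiffAt_extend _ _ _)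
  have hli : LinearIndependent ℝ fun i => s i x := by
    simp only [hs, FiberBundle.extend_apply_self]
    exact b.linearIndependent.map' (mfderiv (𝓡 k) (𝓡 m) f x).toLinearMap
      (LinearMap.ker_eq_bot.2 (hf.injective x))
  refine (hW.sub (starProjection_span hsm hli hW)).congr ?_
  have hev : ∀ᶠ y in 𝓝 x, y ∈ (trivializationAt (EuclideanSpace ℝ (Fin k))
      (fun y : M => TangentSpace (𝓡 k) y) x).baseSet :=
    (trivializationAt (EuclideanSpace ℝ (Fin k)) (fun y : M => TangentSpace (𝓡 k) y)
      x).open_baseSet.mem_nhds (FiberBundle.mem_baseSet_trivializationAt' x)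
  filter_upwards [hev] with y hy
  have h := starProjection_congr (span_range_mfderiv_extend f b hy) (W y)
  rw [normalPart_eq_sub]
  exact congrArg (W y - ·) h.symm

end SmoothAlong
-- Linear algebra of slant subspaces
section LinearAlgebra

variable {E : Type*} [NormedAddCommGroup E] [InnerProductSpace ℝ E] [FiniteDimensional ℝ E]

/-- Comes from ⟨w,Pw⟩ = ‖Pw‖². If Pw = 0 the angle is π/2 by convention and both sides vanish. -/
theorem norm_starProjection_eq_cos_angle_mul (K : Submodule ℝ E) (w : E) :
    ‖K.starProjection w‖ =
      Real.cos (InnerProductGeometry.angle w (K.starProjection w)) * ‖w‖ := by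
  have h := InnerProductGeometry.cos_angle_mul_norm_mul_norm w (K.starProjection w)
  have h2 : inner ℝ w (K.starProjection w) = ‖K.starProjection w‖ ^ 2 := by
    rw [← real_inner_self_eq_norm_sq, K.inner_starProjection_left_eq_right,
      K.starProjection_eq_self_iff.2 (K.starProjection_apply_mem w)]
  rw [h2] at h
  by_cases h0 : K.starProjection w = 0
  · simp [h0]
  · have : ‖K.starProjection w‖ ≠ 0 := norm_ne_zero_iff.2 h0
    apply mul_right_cancel₀ this
    rw [mul_assoc, h]
    ring

/-- Needed to rule out cos θ = -1, so that cos²θ = 1 leaves only θ = 0. -/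
theorem cos_angle_starProjection_nonneg (K : Submodule ℝ E) (w : E) :
    0 ≤ Real.cos (InnerProductGeometry.angle w (K.starProjection w)) := by
  by_cases h0 : w = 0
  · simp [h0]
  · have h := norm_starProjection_eq_cos_angle_mul K w
    by_contra! hc
    have := mul_neg_of_neg_of_pos hc (norm_pos_iff.2 h0)
    linarith [norm_nonneg (K.starProjection w)]

variable {J : E →L[ℝ] E} {p q : ℝ} {D : Submodule ℝ E} {θ : ℝ}

/-- Polarization of ‖PJv‖ = cos θ ‖Jv‖, where P projects onto D. -/
theorem inner_starProjection_of_slant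
    (hslant : ∀ v ∈ D, v ≠ 0 → InnerProductGeometry.angle (J v) (D.starProjection (J v)) = θ)
    {v w : E} (hv : v ∈ D) (hw : w ∈ D) :
    inner ℝ (D.starProjection (J v)) (D.starProjection (J w)) =
      Real.cos θ ^ 2 * inner ℝ (J v) (J w) := by
  have hn : ∀ v ∈ D, ‖D.starProjection (J v)‖ = Real.cos θ * ‖J v‖ := by
    intro v hv
    by_cases h0 : v = 0
    · simp [h0]
    · rw [norm_starProjection_eq_cos_angle_mul, hslant v hv h0]
  have h1 := hn _ hv
  have h2 := hn _ hw
  have h3 := hn _ (D.add_mem hv hw)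
  rw [map_add, map_add] at h3
  rw [real_inner_eq_norm_add_mul_self_sub_norm_mul_self_sub_norm_mul_self_div_two,
    real_inner_eq_norm_add_mul_self_sub_norm_mul_self_sub_norm_mul_self_div_two (J v), h1, h2, h3]
  ring

/-- Tested against w in D: ⟨PJPJz,w⟩ = ⟨PJz,PJw⟩ = cos²θ ⟨Jz,Jw⟩ = cos²θ ⟨J²z,w⟩. The difference of
the two sides lies in D and is orthogonal to D. -/
theorem starProjection_sq_of_slant (hsymm : ∀ v w, inner ℝ (J v) w = inner ℝ v (J w))
    (hsq : ∀ v, J (J v) = p • J v + q • v)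
    (hslant : ∀ v ∈ D, v ≠ 0 → InnerProductGeometry.angle (J v) (D.starProjection (J v)) = θ)
    {z : E} (hz : z ∈ D) :
    D.starProjection (J (D.starProjection (J z))) =
      Real.cos θ ^ 2 • (p • D.starProjection (J z) + q • z) := by
  set r := D.starProjection (J (D.starProjection (J z))) -
    Real.cos θ ^ 2 • (p • D.starProjection (J z) + q • z) with hr
  have hmem : r ∈ D := D.sub_mem (D.starProjection_apply_mem _)
    (D.smul_mem _ (D.add_mem (D.smul_mem _ (D.starProjection_apply_mem _)) (D.smul_mem _ hz)))
  have hself : ∀ w ∈ D, D.starProjection w = w := fun w hw => D.starProjection_eq_self_iff.2 hw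
  have horth : ∀ w ∈ D, inner ℝ r w = 0 := by
    intro w hw
    have h := inner_starProjection_of_slant hslant hz hw
    rw [← hsymm (J z), hsq, inner_add_left, inner_smul_left, inner_smul_left] at h
    rw [hr, inner_sub_left, D.inner_starProjection_left_eq_right, hself w hw, hsymm (D.starProjection _),
      inner_smul_left, inner_add_left, inner_smul_left, inner_smul_left,
      D.inner_starProjection_left_eq_right (J z) w, hself w hw]
    rw [D.inner_starProjection_left_eq_right, hself _ (D.starProjection_apply_mem _)] at h
    rw [D.inner_starProjection_left_eq_right, h]
    simp
  exact sub_eq_zero.1 (inner_self_eq_zero.1 (horth r hmem))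

/-- If the tangential part of `J` satisfies on `s` the same equation as `J`, then `s` pairs to zero
with `p T z + q z` for every `z` in a slant subspace. -/
theorem inner_eq_zero_of_slant {K D₁ D₂ : Submodule ℝ E} (hsup : D₁ ⊔ D₂ = K) (hperp : D₁ ⟂ D₂)
    (hinv : ∀ v ∈ D₁, J v ∈ D₁) (hsymm : ∀ v w, inner ℝ (J v) w = inner ℝ v (J w))
    (hsq : ∀ v, J (J v) = p • J v + q • v)
    (hslant : ∀ v ∈ D₂, v ≠ 0 → InnerProductGeometry.angle (J v) (D₂.starProjection (J v)) = θ)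
    (hθ : θ ≠ 0) {s z : E} (hs : s ∈ K) (hz : z ∈ D₂)
    (hsT : K.starProjection (J (K.starProjection (J s))) = p • K.starProjection (J s) + q • s) :
    p * inner ℝ (K.starProjection (J s)) z + q * inner ℝ s z = 0 := by
  by_cases hz0 : z = 0
  · simp [hz0]
  have hK : ∀ w ∈ K, K.starProjection w = w := fun w hw => K.starProjection_eq_self_iff.2 hw
  have hD : D₂ ≤ K := hsup ▸ le_sup_right
  -- J maps D₂ into the complement of D₁, by symmetry and invariance of D₁, so projecting to K is
  -- the same as projecting to D₂.
  have hT : ∀ w ∈ D₂, K.starProjection (J w) = D₂.starProjection (J w) := by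
    intro w hw
    refine Submodule.eq_starProjection_of_mem_orthogonal (hD (D₂.starProjection_apply_mem _)) ?_
    rw [← hsup, Submodule.mem_orthogonal]
    intro u hu
    obtain ⟨a, ha, b, hb, rfl⟩ := Submodule.mem_sup.1 hu
    have h1 : inner ℝ a (J w) = 0 := by
      rw [← hsymm]; exact hperp.inner_eq (hinv a ha) hw
    have h2 : inner ℝ a (D₂.starProjection (J w)) = 0 :=
      hperp.inner_eq ha (D₂.starProjection_apply_mem _)
    have h3 : inner ℝ b (J w - D₂.starProjection (J w)) = 0 :=
      D₂.sub_starProjection_mem_orthogonal (J w) b hb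
    rw [inner_add_left, h3, inner_sub_right, h1, h2]
    simp
  have hadj : ∀ u ∈ K, ∀ w ∈ D₂,
      inner ℝ (K.starProjection (J u)) w = inner ℝ u (D₂.starProjection (J w)) := by
    intro u hu w hw
    rw [K.inner_starProjection_left_eq_right, hK w (hD hw), hsymm, ← hT w hw,
      ← K.inner_starProjection_left_eq_right, hK u hu]
  -- The nonzero z realizes θ as an angle with a projection, so cos θ ≥ 0 and θ lies in [0, π],
  -- where cosine is injective.
  have hcos : Real.cos θ ^ 2 ≠ 1 := by
    have h0 := cos_angle_starProjection_nonneg D₂ (J z)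
    have hang := hslant z hz hz0
    rw [hang] at h0
    intro h1
    have hc : Real.cos θ = 1 := by nlinarith
    apply hθ
    rw [← hang] at hc ⊢
    exact (Real.injOn_cos ⟨InnerProductGeometry.angle_nonneg _ _,
      InnerProductGeometry.angle_le_pi _ _⟩ ⟨le_rfl, Real.pi_pos.le⟩ (by rw [hc, Real.cos_zero]))
  -- ⟨T²s,z⟩ is evaluated twice: by the equation for s, and by moving both factors T onto z.
  have e1 := hadj _ (K.starProjection_apply_mem (J s)) z hz
  rw [hadj s hs _ (D₂.starProjection_apply_mem _), starProjection_sq_of_slant hsymm hsq hslant hz,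
    hsT, inner_smul_right, inner_add_right, inner_smul_right, inner_smul_right, inner_add_left,
    inner_smul_left, inner_smul_left, ← hadj s hs z hz] at e1
  simp only [conj_trivial] at e1
  have : (1 - Real.cos θ ^ 2) * (p * inner ℝ (K.starProjection (J s)) z + q * inner ℝ s z) = 0 := by
    linear_combination e1
  exact (mul_eq_zero.1 this).resolve_left (sub_ne_zero.2 hcos.symm)

end LinearAlgebra

/-! ### Shape operator and second fundamental form -/

section Submanifold

variable {k m : ℕ}
  {M : Type*} [TopologicalSpace M] [ChartedSpace (EuclideanSpace ℝ (Fin k)) M]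
  {N : Type*} [TopologicalSpace N] [ChartedSpace (EuclideanSpace ℝ (Fin m)) N]
  [IsManifold (𝓡 m) ∞ N]

/-- The induced connection is linear in the direction of differentiation. -/
theorem exists_covAlong_eq
    (nabla : CovariantDerivative (𝓡 m) (EuclideanSpace ℝ (Fin m))
      (fun y : N => TangentSpace (𝓡 m) y))
    (f : M → N) (W : (x : M) → TangentSpace (𝓡 m) (f x)) (x : M) :
    ∃ L : TangentSpace (𝓡 k) x →L[ℝ] TangentSpace (𝓡 m) (f x),
      ∀ v, covAlong nabla f W x v = L v := by
  let e := trivializationAt (EuclideanSpace ℝ (Fin m))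
    (fun y : N => TangentSpace (𝓡 m) y) (f x)
  let c : M → EuclideanSpace ℝ (Fin m) :=
    fun x' => (e (⟨f x', W x'⟩ : TangentBundle (𝓡 m) N)).2
  refine ⟨(e.symmL ℝ (f x)).comp (mvfderiv (𝓡 k) c x) +
    (nabla (fun y => e.symm y (c x)) (f x)).comp (mfderiv (𝓡 k) (𝓡 m) f x), fun v => ?_⟩
  have h := e.symmL_apply (R := ℝ) (FiberBundle.mem_baseSet_trivializationAt' (f x))
    (mvfderiv (𝓡 k) c x v)
  exact congrArg (· + nabla (fun y => e.symm y (c x)) (f x) (mfderiv (𝓡 k) (𝓡 m) f x v)) h.symm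

variable [RiemannianBundle (fun y : N => TangentSpace (𝓡 m) y)]

-- The projection lies in the range of df, so `Function.invFun` returns a genuine preimage even
-- where df is not injective.
omit [IsManifold (𝓡 m) ∞ N] in
theorem mfderiv_tangentialPart (f : M → N) (x : M) (w : TangentSpace (𝓡 m) (f x)) :
    mfderiv (𝓡 k) (𝓡 m) f x (tangentialPart f x w) =
      (tangentImage (k := k) (m := m) f x).starProjection w := by
  have h := (tangentImage (k := k) (m := m) f x).starProjection_apply_mem w
  exact Function.invFun_eq (f := mfderiv (𝓡 k) (𝓡 m) f x) (LinearMap.mem_range.1 h)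

theorem mfderiv_shapeOperator
    (nabla : CovariantDerivative (𝓡 m) (EuclideanSpace ℝ (Fin m))
      (fun y : N => TangentSpace (𝓡 m) y))
    (f : M → N) (V : (x : M) → TangentSpace (𝓡 m) (f x)) (X : (x : M) → TangentSpace (𝓡 k) x)
    (x : M) :
    mfderiv (𝓡 k) (𝓡 m) f x (shapeOperator nabla f V X x) =
      -(tangentImage (k := k) (m := m) f x).starProjection (covAlong nabla f V x (X x)) := by
  rw [shapeOperator, map_neg, mfderiv_tangentialPart]

variable [IsContMDiffRiemannianBundle (𝓡 m) ∞ (EuclideanSpace ℝ (Fin m))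
    (fun y : N => TangentSpace (𝓡 m) y)]

/-- The shape operator is dual to the second fundamental form. -/
theorem inner_secondFundamentalForm [IsManifold (𝓡 k) ∞ M]
    {nabla : CovariantDerivative (𝓡 m) (EuclideanSpace ℝ (Fin m))
      (fun y : N => TangentSpace (𝓡 m) y)} (hmetric : nabla.IsMetricCompatible)
    {f : M → N} (hf : ContMDiff (𝓡 k) (𝓡 m) ∞ f)
    {V : (x : M) → TangentSpace (𝓡 m) (f x)} (hV : IsSmoothNormalField (k := k) f V)
    (X : (x : M) → TangentSpace (𝓡 k) x)
    {Y : (x : M) → TangentSpace (𝓡 k) x} (hY : IsSmoothField Y) (x : M) :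
    (inner ℝ (secondFundamentalForm nabla f X Y x) (V x) : ℝ) =
      inner ℝ (mfderiv (𝓡 k) (𝓡 m) f x (shapeOperator nabla f V X x))
        (mfderiv (𝓡 k) (𝓡 m) f x (Y x)) := by
  have hYs : IsSmoothAlongAt (k := k) f (push f Y) x :=
    isSmoothAlongAt_mfderiv hf (hY x)
  -- Differentiate ⟨V, f_*Y⟩ = 0 in the direction X x.
  have h := mvfderiv_inner_along hmetric ((hV.1 x).mdifferentiableAt (by simp))
    (ContMDiffAt.mdifferentiableAt hYs (by simp)) (X x)
  have h0 : (fun x' => (inner ℝ (V x') (push f Y x') : ℝ)) = fun _ => 0 := by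
    funext x'
    have hmem : push f Y x' ∈ tangentImage (k := k) (m := m) f x' :=
      LinearMap.mem_range_self _ (Y x')
    have hVx : V x' ∈ (tangentImage (k := k) (m := m) f x')ᗮ := hV.2 x'
    exact Submodule.inner_left_of_mem_orthogonal hmem hVx
  rw [h0, mfderiv_const] at h
  have hmem : mfderiv (𝓡 k) (𝓡 m) f x (Y x) ∈ tangentImage (k := k) (m := m) f x := ⟨Y x, rfl⟩
  rw [mfderiv_shapeOperator, inner_neg_left, Submodule.inner_starProjection_left_eq_right,
    Submodule.starProjection_eq_self_iff.2 hmem, secondFundamentalForm, normalPart,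
    Submodule.inner_starProjection_left_eq_right, Submodule.starProjection_eq_self_iff.2 (hV.2 x)]
  rw [real_inner_comm]
  exact eq_neg_of_add_eq_zero_right h.symm

end Submanifold

/-! ### The identity p n h(X,Y) + q h(X,Y) = 0 on semi-slant submanifolds -/

section SemiSlant

variable {k m : ℕ}
  {M : Type*} [TopologicalSpace M] [T2Space M] [ChartedSpace (EuclideanSpace ℝ (Fin k)) M]
  [IsManifold (𝓡 k) ∞ M]
  {N : Type*} [TopologicalSpace N] [ChartedSpace (EuclideanSpace ℝ (Fin m)) N]
  [IsManifold (𝓡 m) ∞ N]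

theorem exists_isSmoothField_extension (x : M) (v : TangentSpace (𝓡 k) x) :
    ∃ X : (x : M) → TangentSpace (𝓡 k) x, IsSmoothField X ∧ X x = v :=
  exists_isSmoothAlong_extension (k := k) (m := k) (f := fun y : M => y) contMDiff_id x v

variable [RiemannianBundle (fun y : N => TangentSpace (𝓡 m) y)]
  [IsContMDiffRiemannianBundle (𝓡 m) ∞ (EuclideanSpace ℝ (Fin m))
    (fun y : N => TangentSpace (𝓡 m) y)]

/-- Extend w along f and project to the normal bundle; the value at x is unchanged because w is
already normal. -/
theorem exists_isSmoothNormalField_extension {f : M → N}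
    (hf : IsSmoothImmersion (k := k) (m := m) f) (x : M) {w : TangentSpace (𝓡 m) (f x)}
    (hw : w ∈ normalSpace (k := k) f x) :
    ∃ V : (x : M) → TangentSpace (𝓡 m) (f x), IsSmoothNormalField (k := k) f V ∧ V x = w := by
  obtain ⟨W, hW, hWx⟩ := exists_isSmoothAlong_extension hf.smooth x w
  refine ⟨fun y => normalPart (k := k) f y (W y),
    ⟨fun y => IsSmoothAlongAt.normalPart hf (hW y),
      fun y => (normalSpace (k := k) (m := m) f y).starProjection_apply_mem (W y)⟩, ?_⟩
  dsimp only
  rw [hWx]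
  exact (normalSpace (k := k) (m := m) f x).starProjection_eq_self_iff.2 hw

omit [T2Space M] in
theorem isSmoothNormalField_opn {J : (y : N) → TangentSpace (𝓡 m) y →L[ℝ] TangentSpace (𝓡 m) y}
    (hJ : IsSmoothEndomorphismField J) {f : M → N} (hf : IsSmoothImmersion (k := k) (m := m) f)
    {V : (x : M) → TangentSpace (𝓡 m) (f x)} (hV : IsSmoothNormalField (k := k) f V) :
    IsSmoothNormalField (k := k) f (fun x => opn (k := k) J f x (V x)) :=
  ⟨fun y => IsSmoothAlongAt.normalPart hf (IsSmoothAlongAt.endomorphism hJ (hV.1 y)),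
    fun y => (normalSpace (k := k) (m := m) f y).starProjection_apply_mem (J (f y) (V y))⟩

variable {nabla : CovariantDerivative (𝓡 m) (EuclideanSpace ℝ (Fin m))
      (fun y : N => TangentSpace (𝓡 m) y)}
  {J : (y : N) → TangentSpace (𝓡 m) y →L[ℝ] TangentSpace (𝓡 m) y} {f : M → N}

omit [T2Space M] [IsManifold (𝓡 k) ∞ M] [IsManifold (𝓡 m) ∞ N]
  [IsContMDiffRiemannianBundle (𝓡 m) ∞ (EuclideanSpace ℝ (Fin m))
    (fun y : N => TangentSpace (𝓡 m) y)] in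
/-- On a `J`-invariant distribution, `T` coincides with `J`. -/
theorem mfderiv_opT_of_invariant {x : M} {D : Submodule ℝ (TangentSpace (𝓡 k) x)}
    (hinv : (pushSubspace f x D).map (J (f x)).toLinearMap = pushSubspace (m := m) f x D)
    {v : TangentSpace (𝓡 k) x} (hv : v ∈ D) :
    mfderiv (𝓡 k) (𝓡 m) f x (opT J f x v) = J (f x) (mfderiv (𝓡 k) (𝓡 m) f x v) := by
  have h1 : J (f x) (mfderiv (𝓡 k) (𝓡 m) f x v) ∈ pushSubspace (m := m) f x D := by
    rw [← hinv]
    exact Submodule.mem_map_of_mem (Submodule.mem_map_of_mem hv)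
  have h2 : J (f x) (mfderiv (𝓡 k) (𝓡 m) f x v) ∈ tangentImage (k := k) (m := m) f x :=
    LinearMap.map_le_range h1
  rw [opT, mfderiv_tangentialPart]
  exact (tangentImage (k := k) (m := m) f x).starProjection_eq_self_iff.2 h2

omit [T2Space M] [IsManifold (𝓡 k) ∞ M] [IsManifold (𝓡 m) ∞ N]
  [IsContMDiffRiemannianBundle (𝓡 m) ∞ (EuclideanSpace ℝ (Fin m))
    (fun y : N => TangentSpace (𝓡 m) y)] in
theorem opT_mem_of_invariant (hf : IsSmoothImmersion (k := k) (m := m) f) {x : M}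
    {D : Submodule ℝ (TangentSpace (𝓡 k) x)}
    (hinv : (pushSubspace f x D).map (J (f x)).toLinearMap = pushSubspace (m := m) f x D)
    {v : TangentSpace (𝓡 k) x} (hv : v ∈ D) : opT J f x v ∈ D := by
  have h1 : J (f x) (mfderiv (𝓡 k) (𝓡 m) f x v) ∈ pushSubspace (m := m) f x D := by
    rw [← hinv]
    exact Submodule.mem_map_of_mem (Submodule.mem_map_of_mem hv)
  obtain ⟨u, hu, hue⟩ := Submodule.mem_map.1 h1
  have : opT J f x v = u :=
    hf.injective x ((mfderiv_opT_of_invariant hinv hv).trans hue.symm)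
  rwa [this]

set_option maxHeartbeats 1600000 in
/-- If `A_{nV} X = T A_V X = A_V T X`, then on a semi-slant submanifold `h(X, Y)` satisfies
`p n h(X, Y) + q h(X, Y) = 0` for `X` in the invariant and `Y` in the slant distribution. -/
theorem opn_secondFundamentalForm_of_isSemiSlant {p q : ℕ}
    (hN : IsLocallyMetallicRiemannian p q nabla J)
    (hf : IsSmoothImmersion (k := k) (m := m) f)
    {D₁ D₂ : (x : M) → Submodule ℝ (TangentSpace (𝓡 k) x)} {d₁ d₂ : ℕ} {θ : ℝ}
    (hM : IsSemiSlant J f D₁ D₂ d₁ d₂ θ)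
    (hA : ∀ (X : (x : M) → TangentSpace (𝓡 k) x) (V : (x : M) → TangentSpace (𝓡 m) (f x)),
      IsSmoothField X → IsSmoothNormalField (k := k) f V → ∀ x : M,
        shapeOperator nabla f (fun x' => opn (k := k) J f x' (V x')) X x =
          opT J f x (shapeOperator nabla f V X x) ∧
        opT J f x (shapeOperator nabla f V X x) =
          shapeOperator nabla f V (fun x' => opT J f x' (X x')) x)
    {X Y : (x : M) → TangentSpace (𝓡 k) x} (hX : IsSmoothSectionOf D₁ X)
    (hY : IsSmoothSectionOf D₂ Y) (x : M) :
    (p : ℝ) • opn (k := k) J f x (secondFundamentalForm nabla f X Y x) +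
      (q : ℝ) • secondFundamentalForm nabla f X Y x = 0 := by
  set H := secondFundamentalForm nabla f X Y x with hH
  set τ := tangentImage (k := k) (m := m) f x with hτ
  set ν := normalSpace (k := k) (m := m) f x with hν
  have hHν : H ∈ ν := ν.starProjection_apply_mem _
  have hnH : opn (k := k) J f x H ∈ ν := ν.starProjection_apply_mem _
  suffices key : ∀ w ∈ ν, (inner ℝ ((p : ℝ) • opn (k := k) J f x H + (q : ℝ) • H) w : ℝ) = 0 from
    inner_self_eq_zero.1 (key _ (ν.add_mem (ν.smul_mem _ hnH) (ν.smul_mem _ hHν)))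
  intro w hw
  obtain ⟨V, hV, rfl⟩ := exists_isSmoothNormalField_extension hf x hw
  have hnV := isSmoothNormalField_opn hN.smooth hf hV
  have hmetric := hN.leviCivita.metric
  obtain ⟨L, hL⟩ := exists_covAlong_eq (k := k) nabla f V x
  -- the image of `A_V v` under `df`, for a tangent vector `v` at `x`
  set σ : TangentSpace (𝓡 k) x → TangentSpace (𝓡 m) (f x) := fun v => -τ.starProjection (L v)
    with hσ
  have hshape : ∀ X' : (x : M) → TangentSpace (𝓡 k) x,
      mfderiv (𝓡 k) (𝓡 m) f x (shapeOperator nabla f V X' x) = σ (X' x) := fun X' => by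
    rw [mfderiv_shapeOperator, hL]
  have hT : ∀ v, mfderiv (𝓡 k) (𝓡 m) f x (opT J f x v) =
      τ.starProjection (J (f x) (mfderiv (𝓡 k) (𝓡 m) f x v)) := fun v =>
    mfderiv_tangentialPart f x _
  -- Commutation of T and A_V for single vectors, obtained by extending v. It is used below at both
  -- X x and TX x.
  have hσT : ∀ v, τ.starProjection (J (f x) (σ v)) = σ (opT J f x v) := by
    intro v
    obtain ⟨X', hX', rfl⟩ := exists_isSmoothField_extension x v
    rw [← hshape X', ← hT, (hA X' V hX' hV x).2, hshape]
  set s := σ (X x) with hs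
  set z := mfderiv (𝓡 k) (𝓡 m) f x (Y x) with hz
  have h1 : (inner ℝ H (V x) : ℝ) = inner ℝ s z := by
    rw [hH, inner_secondFundamentalForm hmetric hf.smooth hV X hY.1 x, hshape]
  -- ⟨nH,V⟩ = ⟨H,nV⟩ = ⟨A_{nV}X,Y⟩ = ⟨TA_VX,Y⟩.
  have h2 : (inner ℝ (opn (k := k) J f x H) (V x) : ℝ) =
      inner ℝ (τ.starProjection (J (f x) s)) z := by
    have h3 := inner_secondFundamentalForm hmetric hf.smooth hnV X hY.1 x
    rw [(hA X V hX.1 hV x).1, hT, hshape] at h3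
    rw [← h3, opn, opn, normalPart, normalPart, ν.inner_starProjection_left_eq_right,
      ν.starProjection_eq_self_iff.2 hw, hN.symm, ← ν.inner_starProjection_left_eq_right,
      ν.starProjection_eq_self_iff.2 hHν]
  have hinv := hM.invariant x
  have hTT : opT J f x (opT J f x (X x)) = (p : ℝ) • opT J f x (X x) + (q : ℝ) • X x := by
    apply hf.injective x
    rw [mfderiv_opT_of_invariant hinv (opT_mem_of_invariant hf hinv (hX.2 x)), map_add, map_smul,
      map_smul, mfderiv_opT_of_invariant hinv (hX.2 x), hN.sq]
  -- T²A_VX = A_VT²X, and T²X is given by the metallic equation on D₁.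
  have hsT : τ.starProjection (J (f x) (τ.starProjection (J (f x) s))) =
      (p : ℝ) • τ.starProjection (J (f x) s) + (q : ℝ) • s := by
    rw [hs, hσT, hσT, hTT]
    simp only [hσ, map_add, map_smul]
    module
  have hsup : pushSubspace (m := m) f x (D₁ x) ⊔ pushSubspace f x (D₂ x) = τ := by
    rw [pushSubspace, pushSubspace, ← Submodule.map_sup, (hM.isCompl x).sup_eq_top,
      Submodule.map_top]
    rfl
  have hslant : ∀ v ∈ pushSubspace (m := m) f x (D₂ x), v ≠ 0 →
      InnerProductGeometry.angle (J (f x) v)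
        ((pushSubspace f x (D₂ x)).starProjection (J (f x) v)) = θ := by
    intro v hv hv0
    obtain ⟨u, hu, rfl⟩ := Submodule.mem_map.1 hv
    refine hM.slant x u hu fun hu0 => hv0 ?_
    rw [hu0, map_zero]
  have hfin := inner_eq_zero_of_slant hsup (hM.orthogonal x)
    (fun v hv => hinv ▸ Submodule.mem_map_of_mem hv) (hN.symm (f x)) (hN.sq (f x)) hslant
    hM.angle_ne_zero (τ.neg_mem (τ.starProjection_apply_mem _))
    (Submodule.mem_map_of_mem (hY.2 x)) hsT
  rw [inner_add_left, inner_smul_left, inner_smul_left, h1, h2]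
  simp only [conj_trivial]
  exact hfin

end SemiSlant

end

end MetallicGeometry

theorem mainTheorem9 {k m : ℕ}
    {M : Type*} [TopologicalSpace M] [T2Space M] [ChartedSpace (EuclideanSpace ℝ (Fin k)) M]
    [IsManifold (𝓡 k) ∞ M]
    {N : Type*} [TopologicalSpace N] [T2Space N] [ChartedSpace (EuclideanSpace ℝ (Fin m)) N]
    [IsManifold (𝓡 m) ∞ N]
    [RiemannianBundle (fun y : N => TangentSpace (𝓡 m) y)]
    [IsContMDiffRiemannianBundle (𝓡 m) ∞ (EuclideanSpace ℝ (Fin m))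
      (fun y : N => TangentSpace (𝓡 m) y)]
    (nabla : CovariantDerivative (𝓡 m) (EuclideanSpace ℝ (Fin m))
      (fun y : N => TangentSpace (𝓡 m) y))
    (J : (y : N) → TangentSpace (𝓡 m) y →L[ℝ] TangentSpace (𝓡 m) y) (p q : ℕ)
    (hN : MetallicGeometry.IsLocallyMetallicRiemannian p q nabla J)
    (f : M → N) (hf : MetallicGeometry.IsSmoothImmersion (k := k) (m := m) f)
    (D₁ D₂ : (x : M) → Submodule ℝ (TangentSpace (𝓡 k) x)) (d₁ d₂ : ℕ) (θ : ℝ)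
    (hM : MetallicGeometry.IsProperSemiSlant J f D₁ D₂ d₁ d₂ θ)
    (hA : ∀ (X : (x : M) → TangentSpace (𝓡 k) x) (V : (x : M) → TangentSpace (𝓡 m) (f x)),
      MetallicGeometry.IsSmoothField X → MetallicGeometry.IsSmoothNormalField (k := k) f V →
      ∀ x : M,
        MetallicGeometry.shapeOperator nabla f
            (fun x' => MetallicGeometry.opn (k := k) J f x' (V x')) X x =
          MetallicGeometry.opT J f x (MetallicGeometry.shapeOperator nabla f V X x) ∧
        MetallicGeometry.opT J f x (MetallicGeometry.shapeOperator nabla f V X x) =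
          MetallicGeometry.shapeOperator nabla f V
            (fun x' => MetallicGeometry.opT J f x' (X x')) x)
    (hn : ∀ X Y : (x : M) → TangentSpace (𝓡 k) x,
      MetallicGeometry.IsSmoothSectionOf D₁ X → MetallicGeometry.IsSmoothSectionOf D₂ Y →
      ¬ MetallicGeometry.IsEigenvectorOfn (k := k) J f (-((q : ℝ) / (p : ℝ)))
          (MetallicGeometry.secondFundamentalForm nabla f X Y)) :
    MetallicGeometry.IsMixedTotallyGeodesic nabla f D₁ D₂ := by

  intro X Y hX hY
  have hp : (p : ℝ) ≠ 0 := Nat.cast_ne_zero.2 hN.p_pos.ne'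
  have h := MetallicGeometry.opn_secondFundamentalForm_of_isSemiSlant hN hf hM.toIsSemiSlant hA
    hX hY
  -- The excluded eigenvectors are whole sections, so the contradiction assumes h(X,Y) is not
  -- identically zero and divides the identity by p at every point.
  have hzero : MetallicGeometry.secondFundamentalForm nabla f X Y = 0 := by
    by_contra hne
    refine hn X Y hX hY ⟨hne, fun x => ?_⟩
    refine smul_right_injective _ hp ?_
    dsimp only
    rw [eq_neg_of_add_eq_zero_left (h x), smul_smul, ← neg_smul]
    congr 1
    field_simp
  exact fun x => congrFun hzero x
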